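/- **Theorem 2.3.** Let $0<q<1$ and let $\alpha,\beta,\gamma\in\mathbb R$ satisfy $0<\alpha q<1$, $0\le\beta q<1$ and $\gamma<0$. Write $(a;q)_i=\prod_{j=0}^{i-1}(1-aq^j)$ for $i\in\mathbb N_0\cup\{\infty\}$ and $(a_1,\dots,a_r;q)_i=(a_1;q)_i\cdots(a_r;q)_i$. For real parameters $a,b,c$ the big $q$-Jacobi polynomials are $$\tilde P_n(x;a,b,c;q)=\frac{(aq,cq;q)_n}{(abq^{n+1};q)_n}\sum_{i=0}^{n}\frac{(q^{-n},abq^{n+1},x;q)_i}{(aq,cq;q)_i}\,\frac{q^i}{(q;q)_i}.$$ Let $$w(x)=\frac{(\alpha^{-1}x,\gamma^{-1}x;q)_\infty}{(x,\beta\gamma^{-1}x;q)_\infty},$$ and let $\int_{\gamma q}^{\alpha q} f(x)\,d_qx=(1-q)\,\alpha q\sum_{j\ge0}f(\alpha q^{j+1})q^j-(1-q)\,\gamma q\sum_{j\ge0}f(\gamma q^{j+1})q^j$ be the Jackson $q$-integral. For integers $0\le r\le n-1$, a polynomial $Q$ of exact degree $n$ is called *quasi-orthogonal of order $r$* with respect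 to $w$ on $(\gamma q,\alpha q)$ if $w>0$ on $[\gamma q,\alpha q]$, all the $q$-integrals $\int_{\gamma q}^{\alpha q}x^jQ(x)w(x)\,d_qx$, $j\in\mathbb N_0$, converge absolutely, and $$\int_{\gamma q}^{\alpha q}x^jQ(x)w(x)\,d_qx\ \begin{cases}=0,& j\in\{0,1,\dots,n-r-1\},\\ \ne0,& j=n-r.\end{cases}$$ Then for all $k,l,m,n\in\mathbb N_0$: 1. if $\alpha>1$ and $k\le n-1$, then $\tilde P_n\big(x;\tfrac{\alpha}{q^k},\beta,\gamma;q\big)$ is quasi-orthogonal of order $k$ with respect to $w$ on $(\gamma q,\alpha q)$ and has at least $n-k$ distinct real zeros in $(\gamma q,\alpha q)$; 2. if $\beta>1$ and $m\le n-1$, then $\tilde P_n\big(x;\alpha,\tfrac{\beta}{q^m},\gamma;q\big)$ is quasi-orthogonal of order $m$ with respect to $w$ on $(\gamma q,\alpha q)$ and has at least $n-m$ distinct real zeros in $(\gamma q,\alpha q)$; 3. if $\beta>1$ and $l\le n-1$, then $\tilde P_n\big(x;\alpha,\tfrac{\beta}{q^l},\tfrac{\gamma}{q^l};q\big)$ is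 quasi-orthogonal of order $l$ with respect to $w$ on $(\gamma q,\alpha q)$ and has at least $n-l$ distinct real zeros in $(\gamma q,\alpha q)$; 4. if $\alpha>1$, $\beta>1$ and $k+m\le n-1$, then $\tilde P_n\big(x;\tfrac{\alpha}{q^k},\tfrac{\beta}{q^m},\gamma;q\big)$ is quasi-orthogonal of order $k+m$ with respect to $w$ on $(\gamma q,\alpha q)$ and has at least $n-(k+m)$ distinct real zeros in $(\gamma q,\alpha q)$. -/

import Mathlib

open Polynomial

/-- The finite `q`-Pochhammer symbol `(a; q)_n = ∏_{j < n} (1 - a q^j)`, over any commutative ring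
(below: over `ℝ`, and over `ℝ[X]` for the polynomial `(x; q)_n` in the variable `x`). -/
def qPoch {R : Type*} [CommRing R] (q a : R) (n : ℕ) : R :=
  ∏ j ∈ Finset.range n, (1 - a * q ^ j)

/-- The infinite `q`-Pochhammer symbol `(a; q)_∞ = ∏_{j ≥ 0} (1 - a q^j)`
(the product converges when `|q| < 1`). -/
noncomputable def qPochInf (q a : ℝ) : ℝ :=
  ∏' j : ℕ, (1 - a * q ^ j)

/-- The basic hypergeometric series `₃φ₂(a₁, a₂, a₃; b₁, b₂; q; z)`. -/
noncomputable def basicHyp32 (q a₁ a₂ a₃ b₁ b₂ z : ℝ) : ℝ :=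
  ∑' i : ℕ, qPoch q a₁ i * qPoch q a₂ i * qPoch q a₃ i / (qPoch q b₁ i * qPoch q b₂ i)
    * (z ^ i / qPoch q q i)

/-- The big `q`-Jacobi polynomial `P̃_n(x; α, β, γ; q)`, i.e.
`(αq;q)_n (γq;q)_n / (αβq^{n+1};q)_n · ₃φ₂(q^{-n}, αβq^{n+1}, x; αq, γq; q; q)`, as a polynomial
in `x`. The series terminates at the index `n`, since `(q^{-n};q)_i = 0` for `i > n`;
see `bigQJacobi_eval`. -/
noncomputable def bigQJacobi (q α β γ : ℝ) (n : ℕ) : ℝ[X] :=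
  C (qPoch q (α * q) n * qPoch q (γ * q) n / qPoch q (α * β * q ^ (n + 1)) n) *
    ∑ i ∈ Finset.range (n + 1),
      C (qPoch q ((q ^ n)⁻¹) i * qPoch q (α * β * q ^ (n + 1)) i
          / (qPoch q (α * q) i * qPoch q (γ * q) i) * (q ^ i / qPoch q q i))
        * qPoch (C q) X i

theorem qPoch_eval (q x : ℝ) (i : ℕ) : (qPoch (C q) X i).eval x = qPoch q x i := by
  simp [qPoch, eval_prod]

/-- The values of the polynomial `bigQJacobi` are given by the `₃φ₂` series. -/
theorem bigQJacobi_eval (q α β γ : ℝ) (hq : q ≠ 0) (n : ℕ) (x : ℝ) :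
    (bigQJacobi q α β γ n).eval x =
      qPoch q (α * q) n * qPoch q (γ * q) n / qPoch q (α * β * q ^ (n + 1)) n *
        basicHyp32 q ((q ^ n)⁻¹) (α * β * q ^ (n + 1)) x (α * q) (γ * q) q := by
  rw [basicHyp32, tsum_eq_sum (s := Finset.range (n + 1))]
  · simp only [bigQJacobi, eval_mul, eval_C, eval_finsetSum, qPoch_eval]
    congr 1
    refine Finset.sum_congr rfl fun i _ => ?_
    ring
  · intro i hi
    have h0 : qPoch q ((q ^ n)⁻¹) i = 0 := by
      refine Finset.prod_eq_zero (i := n) ?_ ?_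
      · simp only [Finset.mem_range] at hi ⊢
        omega
      · rw [inv_mul_cancel₀ (pow_ne_zero n hq), sub_self]
    simp [h0]

/-- The weight `w(x) = (x/α, x/γ; q)_∞ / (x, βx/γ; q)_∞` of the big `q`-Jacobi polynomials. -/
noncomputable def bigQJacobiWeight (q α β γ x : ℝ) : ℝ :=
  qPochInf q (α⁻¹ * x) * qPochInf q (γ⁻¹ * x) / (qPochInf q x * qPochInf q (β * γ⁻¹ * x))

/-- The `q`-integral `∫_a^b f(x) d_q x` converges: the two series defining it are summable. -/
def QIntegrable (q a b : ℝ) (f : ℝ → ℝ) : Prop :=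
  Summable (fun j : ℕ => f (a * q ^ j) * q ^ j) ∧ Summable (fun j : ℕ => f (b * q ^ j) * q ^ j)

/-- The (Jackson) `q`-integral
`∫_a^b f(x) d_q x = b(1-q) ∑_{j ≥ 0} f(b q^j) q^j - a(1-q) ∑_{j ≥ 0} f(a q^j) q^j`. -/
noncomputable def qIntegral (q a b : ℝ) (f : ℝ → ℝ) : ℝ :=
  b * (1 - q) * ∑' j : ℕ, f (b * q ^ j) * q ^ j - a * (1 - q) * ∑' j : ℕ, f (a * q ^ j) * q ^ j

/-- `Q`, a polynomial of exact degree `n`, is quasi-orthogonal of order `k ≤ n - 1` on `(a, b)`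
with respect to the weight `w > 0` and the `q`-integral: `∫_a^b x^m Q(x) w(x) d_q x` is zero for
`m = 0, …, n-k-1`, and is not zero for `m = n-k` (so that the order is exactly `k`). -/
structure IsQuasiOrthogonal (q a b : ℝ) (w : ℝ → ℝ) (Q : ℝ[X]) (n k : ℕ) : Prop where
  weight_pos : ∀ x ∈ Set.Icc a b, 0 < w x
  order_lt : k < n
  natDegree_eq : Q.natDegree = n
  integrable : ∀ m : ℕ, QIntegrable q a b (fun x => x ^ m * Q.eval x * w x)
  integral_eq_zero : ∀ m : ℕ, m < n - k → qIntegral q a b (fun x => x ^ m * Q.eval x * w x) = 0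
  integral_ne_zero : qIntegral q a b (fun x => x ^ (n - k) * Q.eval x * w x) ≠ 0

/-- `Q` has at least `r` distinct real zeros in the open interval `(a, b)`. -/
def HasAtLeastZeros (Q : ℝ[X]) (r : ℕ) (a b : ℝ) : Prop :=
  ∃ s : Finset ℝ, r ≤ s.card ∧ ∀ x ∈ s, x ∈ Set.Ioo a b ∧ Q.IsRoot x

/-!
On the lattices `α q^{j+1}`, `γ q^{j+1}` the weight satisfies a Pearson equation, and `P̃_n` is an
eigenfunction of a second-order `q`-difference operator. By the Lagrange identity
`(λ_m - λ_n) P̃_m P̃_n w` is a total `q`-difference; its boundary terms vanish at `α` and `γ` and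
cancel at the common limit point `0`, so the polynomials with parameters `α, β, γ` are orthogonal.

Dividing a parameter by `q` costs exactly one degree of orthogonality, by the contiguous relations
`P̃_{n+1}(x; a, b, c) = P̃_{n+1}(x; aq, b, c) + K P̃_n(x; aq, b, c)` and
`P̃_{n+1}(x; a, b, c) = P̃_{n+1}(x; a, bq, c) + M P̃_n(x; a, bq, c)` with nonzero `K` and `M`.
Dividing `b` and `c` simultaneously reduces to dividing `a`, by the symmetry
`P̃_n(x; a, b, c) = P̃_n(x; c, ab/c, a)`. As the weight is positive, `Q` must change sign at least
as many times as it has degrees of orthogonality.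
-/

open Filter Topology

/-! ### Coefficients of the big `q`-Jacobi polynomials -/

section QPochhammer

variable {R : Type*} [CommRing R] (q a : R)

theorem qPoch_zero : qPoch q a 0 = 1 := by simp [qPoch]

theorem qPoch_succ (n : ℕ) : qPoch q a (n + 1) = qPoch q a n * (1 - a * q ^ n) :=
  Finset.prod_range_succ _ _

theorem qPoch_add (m n : ℕ) : qPoch q a (m + n) = qPoch q a m * qPoch q (a * q ^ m) n := by
  simp only [qPoch, Finset.prod_range_add, pow_add, mul_assoc]

theorem qPoch_succ' (n : ℕ) : qPoch q a (n + 1) = (1 - a) * qPoch q (a * q) n := by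
  rw [add_comm, qPoch_add, qPoch_succ, qPoch_zero, pow_zero, pow_one, mul_one, one_mul]

end QPochhammer

theorem qPoch_ne_zero {K : Type*} [Field K] {q a : K} {n : ℕ} (h : ∀ j < n, a * q ^ j ≠ 1) :
    qPoch q a n ≠ 0 :=
  Finset.prod_ne_zero_iff.2 fun j hj => sub_ne_zero.2 (h j (Finset.mem_range.1 hj)).symm

theorem qPoch_self_ne_zero {q : ℝ} (hq0 : 0 < q) (hq1 : q < 1) (n : ℕ) : qPoch q q n ≠ 0 :=
  qPoch_ne_zero fun _ _ => by
    rw [← pow_succ']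
    exact (pow_lt_one₀ hq0.le hq1 (Nat.succ_ne_zero _)).ne

theorem qPoch_inv_pow_ne_zero {q : ℝ} (hq0 : 0 < q) (hq1 : q < 1) {n i : ℕ} (hi : i ≤ n) :
    qPoch q ((q ^ n)⁻¹) i ≠ 0 :=
  qPoch_ne_zero fun _ hj h => (pow_lt_pow_right_of_lt_one₀ hq0 hq1 (hj.trans_le hi)).ne
    ((inv_mul_eq_one₀ (pow_pos hq0 n).ne').1 h)

theorem qPoch_inv_pow_succ {q : ℝ} (hq : q ≠ 0) (n i : ℕ) :
    qPoch q ((q ^ (n + 1))⁻¹) i * (q ^ (n + 1) - q ^ i) =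
      (q ^ (n + 1) - 1) * qPoch q ((q ^ n)⁻¹) i := by
  have hcancel : q ^ (n + 1) * (q ^ (n + 1))⁻¹ = 1 := mul_inv_cancel₀ (pow_ne_zero _ hq)
  have hshift : (q ^ (n + 1))⁻¹ * q = (q ^ n)⁻¹ := by
    rw [pow_succ, mul_inv, inv_mul_cancel_right₀ hq]
  have hsplit : qPoch q ((q ^ (n + 1))⁻¹) i * (1 - (q ^ (n + 1))⁻¹ * q ^ i) =
      (1 - (q ^ (n + 1))⁻¹) * qPoch q ((q ^ n)⁻¹) i := by
    rw [← qPoch_succ, qPoch_succ', hshift]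
  linear_combination q ^ (n + 1) * hsplit +
    (qPoch q ((q ^ (n + 1))⁻¹) i * q ^ i - qPoch q ((q ^ n)⁻¹) i) * hcancel

theorem degree_qPoch_X {K : Type*} [Field K] {q : K} (hq : q ≠ 0) (i : ℕ) :
    (qPoch (C q) X i : K[X]).degree = i := by
  induction i with
  | zero => rw [qPoch_zero, degree_one, Nat.cast_zero]
  | succ i ih =>
    have hlinear : (1 - X * C q ^ i : K[X]) = C (-q ^ i) * X + C 1 := by
      simp only [C_neg, C_pow, C_1]
      ring
    rw [qPoch_succ, degree_mul, ih, hlinear, degree_linear (neg_ne_zero.2 (pow_ne_zero i hq)),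
      Nat.cast_add, Nat.cast_one]

/-- The parameters for which no denominator vanishes in the big `q`-Jacobi polynomial of degree
`n`. All larger powers of `q` are excluded as well, so that the condition is inherited by the
contiguous polynomials; the power `q ^ 1` may equal `(ab)⁻¹` because it does not occur in the
empty product `(abq; q)_0`. -/
structure BigQJacobiRegular (q a b c : ℝ) (n : ℕ) : Prop where
  a_ne : ∀ j, a * q ^ (j + 1) ≠ 1
  c_ne : ∀ j, c * q ^ (j + 1) ≠ 1
  ab_ne : ∀ j, 2 ≤ j → n < j → a * b * q ^ j ≠ 1

namespace BigQJacobiRegular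

variable {q a b c : ℝ} {n : ℕ}

theorem shift_a (h : BigQJacobiRegular q a b c (n + 1)) : BigQJacobiRegular q (a * q) b c n where
  a_ne j := by convert h.a_ne (j + 1) using 1; ring
  c_ne := h.c_ne
  ab_ne j _ hn := by convert h.ab_ne (j + 1) (by omega) (by omega) using 1; ring

theorem shift_b (h : BigQJacobiRegular q a b c (n + 1)) : BigQJacobiRegular q a (b * q) c n where
  a_ne := h.a_ne
  c_ne := h.c_ne
  ab_ne j _ hn := by convert h.ab_ne (j + 1) (by omega) (by omega) using 1; ring

theorem succ (h : BigQJacobiRegular q a b c n) : BigQJacobiRegular q a b c (n + 1) where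
  a_ne := h.a_ne
  c_ne := h.c_ne
  ab_ne j hj hn := h.ab_ne j hj (n.lt_succ_self.trans hn)

theorem swap (h : BigQJacobiRegular q a b c n) (hc : c ≠ 0) :
    BigQJacobiRegular q c (a * b / c) a n where
  a_ne := h.c_ne
  c_ne := h.a_ne
  ab_ne := by rw [mul_div_cancel₀ _ hc]; exact h.ab_ne

theorem one_sub_ne_zero (h : BigQJacobiRegular q a b c n) {j : ℕ} (hj : 2 ≤ j) (hn : n < j) :
    1 - a * b * q ^ j ≠ 0 :=
  sub_ne_zero.2 (h.ab_ne j hj hn).symm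

theorem qPoch_ab_ne_zero (h : BigQJacobiRegular q a b c n) {i j : ℕ} (hi : n < i)
    (hj : j ≤ n) : qPoch q (a * b * q ^ i) j ≠ 0 :=
  qPoch_ne_zero fun l hl => by
    rw [mul_assoc (a * b), ← pow_add]
    exact h.ab_ne _ (by omega) (by omega)

end BigQJacobiRegular

/-- The coefficient of `(x; q)_i`, `i ≤ n`, in the big `q`-Jacobi polynomial of degree `n`. The
quotients `(aq; q)_n / (aq; q)_i` of the definition are written as products `(aq^{i+1}; q)_{n-i}`,
so that the coefficient of `(x; q)_n` visibly does not depend on `a`, `b`, `c`. -/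
noncomputable def bigQJacobiCoeff (q a b c : ℝ) (n i : ℕ) : ℝ :=
  qPoch q ((q ^ n)⁻¹) i * (q ^ i / qPoch q q i) *
    (qPoch q (a * q ^ (i + 1)) (n - i) * qPoch q (c * q ^ (i + 1)) (n - i) /
      qPoch q (a * b * q ^ (n + 1 + i)) (n - i))

theorem bigQJacobi_eq_sum {q a b c : ℝ} {n : ℕ} (h : BigQJacobiRegular q a b c n) :
    bigQJacobi q a b c n =
      ∑ i ∈ Finset.range (n + 1), C (bigQJacobiCoeff q a b c n i) * qPoch (C q) X i := by
  rw [bigQJacobi, Finset.mul_sum]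
  refine Finset.sum_congr rfl fun i hi => ?_
  obtain ⟨d, rfl⟩ := Nat.exists_eq_add_of_le (Finset.mem_range_succ_iff.1 hi)
  rw [← mul_assoc, ← C_mul]
  congr 2
  have ha : qPoch q (a * q) i ≠ 0 := qPoch_ne_zero fun j _ => by
    convert h.a_ne j using 1; ring
  have hc : qPoch q (c * q) i ≠ 0 := qPoch_ne_zero fun j _ => by
    convert h.c_ne j using 1; ring
  have hab : qPoch q (a * b * q ^ (i + d + 1)) i ≠ 0 :=
    h.qPoch_ab_ne_zero (by omega) (by omega)
  rw [bigQJacobiCoeff, Nat.add_sub_cancel_left, qPoch_add q (a * q), qPoch_add q (c * q),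
    qPoch_add q (a * b * q ^ (i + d + 1)), mul_assoc a q, mul_assoc c q, ← pow_succ',
    mul_assoc (a * b), ← pow_add]
  generalize qPoch q (a * q) i = A, qPoch q (c * q) i = B,
    qPoch q (a * b * q ^ (i + d + 1)) i = D at ha hc hab ⊢
  field_simp

theorem bigQJacobiCoeff_self (q a b c : ℝ) (n : ℕ) :
    bigQJacobiCoeff q a b c n n = qPoch q ((q ^ n)⁻¹) n * (q ^ n / qPoch q q n) := by
  simp only [bigQJacobiCoeff, Nat.sub_self, qPoch_zero, mul_one, div_one]

theorem degree_bigQJacobi {q a b c : ℝ} (hq0 : 0 < q) (hq1 : q < 1) {n : ℕ}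
    (h : BigQJacobiRegular q a b c n) : (bigQJacobi q a b c n).degree = n := by
  have hlead : bigQJacobiCoeff q a b c n n ≠ 0 := by
    rw [bigQJacobiCoeff_self]
    exact mul_ne_zero (qPoch_inv_pow_ne_zero hq0 hq1 le_rfl)
      (div_ne_zero (pow_pos hq0 n).ne' (qPoch_self_ne_zero hq0 hq1 n))
  have htop : (C (bigQJacobiCoeff q a b c n n) * qPoch (C q) X n).degree = n := by
    rw [degree_C_mul hlead, degree_qPoch_X hq0.ne']
  have hlower : (∑ i ∈ Finset.range n,
      C (bigQJacobiCoeff q a b c n i) * qPoch (C q) X i).degree < n := by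
    rw [← mem_degreeLT]
    refine Submodule.sum_mem _ fun i hi => ?_
    rw [← smul_eq_C_mul]
    refine Submodule.smul_mem _ _ (mem_degreeLT.2 ?_)
    rw [degree_qPoch_X hq0.ne']
    exact_mod_cast Finset.mem_range.1 hi
  rw [bigQJacobi_eq_sum h, Finset.sum_range_succ, degree_add_eq_right_of_degree_lt, htop]
  rwa [htop]

theorem bigQJacobi_swap (q a b : ℝ) {c : ℝ} (hc : c ≠ 0) (n : ℕ) :
    bigQJacobi q a b c n = bigQJacobi q c (a * b / c) a n := by
  simp only [bigQJacobi, mul_div_cancel₀ _ hc, mul_comm (qPoch q (a * q) _)]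

theorem sum_qPoch_eq_add_C_mul {R : Type*} [CommRing R] {q K : R} {n : ℕ} {u v w : ℕ → R}
    (h : ∀ i ≤ n, u i = v i + K * w i) (htop : u (n + 1) = v (n + 1)) :
    (∑ i ∈ Finset.range (n + 2), C (u i) * qPoch (C q) X i : R[X]) =
      ∑ i ∈ Finset.range (n + 2), C (v i) * qPoch (C q) X i +
        C K * ∑ i ∈ Finset.range (n + 1), C (w i) * qPoch (C q) X i := by
  rw [Finset.sum_range_succ, Finset.sum_range_succ _ (n + 1), htop, Finset.mul_sum,
    add_right_comm, ← Finset.sum_add_distrib]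
  congr 1
  refine Finset.sum_congr rfl fun i hi => ?_
  rw [h i (Finset.mem_range_succ_iff.1 hi), C_add, C_mul]
  ring

/-! ### Contiguous relations -/

/-- The coefficient `K` in the contiguous relation
`P̃_{n+1}(x; a, b, c) = P̃_{n+1}(x; aq, b, c) + K P̃_n(x; aq, b, c)`. -/
noncomputable def contiguousCoeffA (q a b c : ℝ) (n : ℕ) : ℝ :=
  -(a * q * (1 - q ^ (n + 1)) * (1 - b * q ^ (n + 1)) * (1 - c * q ^ (n + 1))) /
    ((1 - a * b * q ^ (2 * n + 2)) * (1 - a * b * q ^ (2 * n + 3)))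

/-- The coefficient `K` in the contiguous relation
`P̃_{n+1}(x; a, b, c) = P̃_{n+1}(x; a, bq, c) + K P̃_n(x; a, bq, c)`. -/
noncomputable def contiguousCoeffB (q a b c : ℝ) (n : ℕ) : ℝ :=
  a * b * q ^ (n + 2) * (1 - q ^ (n + 1)) * (1 - a * q ^ (n + 1)) * (1 - c * q ^ (n + 1)) /
    ((1 - a * b * q ^ (2 * n + 2)) * (1 - a * b * q ^ (2 * n + 3)))

section Contiguous

variable {q a b c : ℝ} {n i : ℕ}

theorem bigQJacobiCoeff_mul_q_left (hi : i ≤ n) :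
    bigQJacobiCoeff q (a * q) b c n i * (1 - a * q ^ (i + 1)) =
      bigQJacobiCoeff q a (b * q) c n i * (1 - a * q ^ (n + 1)) := by
  obtain ⟨d, rfl⟩ := Nat.exists_eq_add_of_le hi
  have hnum : (1 - a * q ^ (i + 1)) * qPoch q (a * q ^ (i + 1) * q) d =
      qPoch q (a * q ^ (i + 1)) d * (1 - a * q ^ (i + d + 1)) := by
    rw [← qPoch_succ', qPoch_succ, mul_assoc a, ← pow_add, add_right_comm]
  rw [bigQJacobiCoeff, bigQJacobiCoeff, mul_right_comm a q (q ^ (i + 1)), mul_right_comm a q b,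
    ← mul_assoc a b q, Nat.add_sub_cancel_left]
  linear_combination qPoch q ((q ^ (i + d))⁻¹) i * (q ^ i / qPoch q q i) *
    (qPoch q (c * q ^ (i + 1)) d / qPoch q (a * b * q * q ^ (i + d + 1 + i)) d) * hnum

theorem bigQJacobiCoeff_mul_q_right (hi : i ≤ n) (h : BigQJacobiRegular q a b c n) :
    bigQJacobiCoeff q a (b * q) c n i * (1 - a * b * q ^ (2 * n + 1)) =
      bigQJacobiCoeff q a b c n i * (1 - a * b * q ^ (n + 1 + i)) := by
  obtain ⟨d, rfl⟩ := Nat.exists_eq_add_of_le hi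
  have hE : qPoch q (a * b * q ^ (i + d + 1 + i)) d ≠ 0 :=
    h.qPoch_ab_ne_zero (by omega) (by omega)
  have hE' : qPoch q (a * b * q ^ (i + d + 1 + i) * q) d ≠ 0 := by
    rw [mul_assoc (a * b), ← pow_succ]
    exact h.qPoch_ab_ne_zero (by omega) (by omega)
  have hden : (1 - a * b * q ^ (i + d + 1 + i)) * qPoch q (a * b * q ^ (i + d + 1 + i) * q) d =
      qPoch q (a * b * q ^ (i + d + 1 + i)) d * (1 - a * b * q ^ (2 * (i + d) + 1)) := by
    rw [← qPoch_succ', qPoch_succ, mul_assoc (a * b), ← pow_add]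
    ring_nf
  rw [bigQJacobiCoeff, bigQJacobiCoeff, ← mul_assoc a b q, mul_right_comm (a * b) q,
    Nat.add_sub_cancel_left, mul_assoc, mul_assoc (qPoch _ _ _ * _), div_mul_eq_mul_div,
    div_mul_eq_mul_div, (div_eq_div_iff hE' hE).2]
  linear_combination -(qPoch q (a * q ^ (i + 1)) d * qPoch q (c * q ^ (i + 1)) d) * hden

theorem bigQJacobiCoeff_succ (hq : q ≠ 0) (hi : i ≤ n)
    (h : BigQJacobiRegular q a b c (n + 1)) :
    bigQJacobiCoeff q a (b * q) c n i *
        ((1 - q ^ (n + 1)) * (1 - a * q ^ (n + 1)) * (1 - c * q ^ (n + 1))) =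
      bigQJacobiCoeff q a b c (n + 1) i *
        ((q ^ i - q ^ (n + 1)) * (1 - a * b * q ^ (2 * n + 2))) := by
  obtain ⟨d, rfl⟩ := Nat.exists_eq_add_of_le hi
  have hS := qPoch_inv_pow_succ hq (i + d) i
  have hy : 1 - a * b * q ^ (2 * (i + d) + 2) ≠ 0 :=
    h.one_sub_ne_zero (by omega) (by omega)
  have hden : qPoch q (a * b * q ^ (i + d + 1 + 1 + i)) (d + 1) =
      qPoch q (a * b * q * q ^ (i + d + 1 + i)) d * (1 - a * b * q ^ (2 * (i + d) + 2)) := by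
    rw [qPoch_succ]
    ring_nf
  have ha : qPoch q (a * q ^ (i + 1)) (d + 1) =
      qPoch q (a * q ^ (i + 1)) d * (1 - a * q ^ (i + d + 1)) := by
    rw [qPoch_succ, mul_assoc a, ← pow_add, add_right_comm]
  have hc : qPoch q (c * q ^ (i + 1)) (d + 1) =
      qPoch q (c * q ^ (i + 1)) d * (1 - c * q ^ (i + d + 1)) := by
    rw [qPoch_succ, mul_assoc c, ← pow_add, add_right_comm]
  have hcancel := inv_mul_cancel₀ hy
  rw [bigQJacobiCoeff, bigQJacobiCoeff, add_assoc i d 1, Nat.add_sub_cancel_left,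
    Nat.add_sub_cancel_left, ha, hc, ← add_assoc, hden, ← mul_assoc a b q, div_eq_mul_inv (_ * _),
    div_eq_mul_inv (_ * _ * _), mul_inv]
  generalize (qPoch q (a * b * q * q ^ (i + d + 1 + i)) d)⁻¹ = W
  linear_combination q ^ i / qPoch q q i * qPoch q (a * q ^ (i + 1)) d *
    qPoch q (c * q ^ (i + 1)) d * W * (1 - a * q ^ (i + d + 1)) * (1 - c * q ^ (i + d + 1)) *
    (qPoch q ((q ^ (i + d + 1))⁻¹) i * (q ^ (i + d + 1) - q ^ i) * hcancel + hS)

theorem bigQJacobiCoeff_contiguous_a (hq : q ≠ 0) (hi : i ≤ n)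
    (h : BigQJacobiRegular q a b c (n + 1)) :
    bigQJacobiCoeff q a b c (n + 1) i = bigQJacobiCoeff q (a * q) b c (n + 1) i +
      contiguousCoeffA q a b c n * bigQJacobiCoeff q (a * q) b c n i := by
  have hs : 1 - a * q ^ (i + 1) ≠ 0 := sub_ne_zero.2 (h.a_ne i).symm
  have hy : 1 - a * b * q ^ (2 * n + 2) ≠ 0 := h.one_sub_ne_zero (by omega) (by omega)
  have hz : 1 - a * b * q ^ (2 * n + 3) ≠ 0 := h.one_sub_ne_zero (by omega) (by omega)
  have hleft : bigQJacobiCoeff q (a * q) b c (n + 1) i * (1 - a * q ^ (i + 1)) =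
      bigQJacobiCoeff q a (b * q) c (n + 1) i * (1 - a * q ^ (n + 2)) :=
    bigQJacobiCoeff_mul_q_left (hi.trans (Nat.le_add_right n 1))
  have hleft' : bigQJacobiCoeff q (a * q) b c n i * (1 - a * q ^ (i + 1)) =
      bigQJacobiCoeff q a (b * q) c n i * (1 - a * q ^ (n + 1)) :=
    bigQJacobiCoeff_mul_q_left hi
  have hright := bigQJacobiCoeff_mul_q_right (hi.trans (Nat.le_add_right n 1)) h
  rw [contiguousCoeffA, div_mul_eq_mul_div, ← sub_eq_iff_eq_add', eq_div_iff (mul_ne_zero hy hz)]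
  refine mul_right_cancel₀ hs ?_
  linear_combination
    (-(1 - a * b * q ^ (2 * n + 2)) * (1 - a * b * q ^ (2 * n + 3))) * hleft
    - (1 - a * b * q ^ (2 * n + 2)) * (1 - a * q ^ (n + 2)) * hright
    + a * q * (1 - b * q ^ (n + 1)) * (1 - q ^ (n + 1)) * (1 - c * q ^ (n + 1)) * hleft'
    + a * q * (1 - b * q ^ (n + 1)) * bigQJacobiCoeff_succ hq hi h

theorem bigQJacobiCoeff_contiguous_b (hq : q ≠ 0) (hi : i ≤ n)
    (h : BigQJacobiRegular q a b c (n + 1)) :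
    bigQJacobiCoeff q a b c (n + 1) i = bigQJacobiCoeff q a (b * q) c (n + 1) i +
      contiguousCoeffB q a b c n * bigQJacobiCoeff q a (b * q) c n i := by
  have hy : 1 - a * b * q ^ (2 * n + 2) ≠ 0 := h.one_sub_ne_zero (by omega) (by omega)
  have hz : 1 - a * b * q ^ (2 * n + 3) ≠ 0 := h.one_sub_ne_zero (by omega) (by omega)
  have hright := bigQJacobiCoeff_mul_q_right (hi.trans (Nat.le_add_right n 1)) h
  rw [contiguousCoeffB, div_mul_eq_mul_div, ← sub_eq_iff_eq_add', eq_div_iff (mul_ne_zero hy hz)]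
  linear_combination
    -(1 - a * b * q ^ (2 * n + 2)) * hright
    - a * b * q ^ (n + 2) * bigQJacobiCoeff_succ hq hi h

theorem bigQJacobi_contiguous_a (hq : q ≠ 0) (h : BigQJacobiRegular q a b c (n + 1)) :
    bigQJacobi q a b c (n + 1) = bigQJacobi q (a * q) b c (n + 1) +
      C (contiguousCoeffA q a b c n) * bigQJacobi q (a * q) b c n := by
  rw [bigQJacobi_eq_sum h, bigQJacobi_eq_sum h.shift_a, bigQJacobi_eq_sum h.shift_a.succ]
  refine sum_qPoch_eq_add_C_mul (fun i hi => bigQJacobiCoeff_contiguous_a hq hi h) ?_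
  rw [bigQJacobiCoeff_self, bigQJacobiCoeff_self]

theorem bigQJacobi_contiguous_b (hq : q ≠ 0) (h : BigQJacobiRegular q a b c (n + 1)) :
    bigQJacobi q a b c (n + 1) = bigQJacobi q a (b * q) c (n + 1) +
      C (contiguousCoeffB q a b c n) * bigQJacobi q a (b * q) c n := by
  rw [bigQJacobi_eq_sum h, bigQJacobi_eq_sum h.shift_b, bigQJacobi_eq_sum h.shift_b.succ]
  refine sum_qPoch_eq_add_C_mul (fun i hi => bigQJacobiCoeff_contiguous_b hq hi h) ?_
  rw [bigQJacobiCoeff_self, bigQJacobiCoeff_self]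

end Contiguous

/-! ### Orthogonality with respect to a linear functional -/

/-- `Q` is orthogonal, with respect to the linear functional `L`, to the polynomials of degree
less than `d` but not to `X ^ d`. The number `d` is the degree of `Q` minus its order of
quasi-orthogonality. -/
structure HasOrthogonalityOrder {R : Type*} [CommRing R] (L : R[X] →ₗ[R] R) (Q : R[X])
    (d : ℕ) : Prop where
  eq_zero : ∀ p : R[X], p.degree < d → L (p * Q) = 0
  ne_zero : L (X ^ d * Q) ≠ 0

theorem HasOrthogonalityOrder.add_C_mul {R : Type*} [CommRing R] [NoZeroDivisors R]
    {L : R[X] →ₗ[R] R} {A B : R[X]} {d : ℕ} {K : R} (hA : HasOrthogonalityOrder L A (d + 1))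
    (hB : HasOrthogonalityOrder L B d) (hK : K ≠ 0) :
    HasOrthogonalityOrder L (A + C K * B) d := by
  have hL (p : R[X]) (hp : p.degree < (d + 1 : ℕ)) :
      L (p * (A + C K * B)) = K * L (p * B) := by
    rw [mul_add, map_add, hA.eq_zero p hp, zero_add, mul_left_comm, ← smul_eq_C_mul, map_smul,
      smul_eq_mul]
  refine ⟨fun p hp => ?_, ?_⟩
  · rw [hL p (hp.trans (by exact_mod_cast d.lt_succ_self)), hB.eq_zero p hp, mul_zero]
  · rw [hL _ ((degree_X_pow_le d).trans_lt (by exact_mod_cast d.lt_succ_self))]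
    exact mul_ne_zero hK hB.ne_zero

theorem hasOrthogonalityOrder_of_sequence {K : Type*} [Field K] {L : K[X] →ₗ[K] K}
    (S : Sequence K) {n : ℕ} (horth : ∀ m < n, L (S m * S n) = 0) (hsq : L (S n * S n) ≠ 0) :
    HasOrthogonalityOrder L (S n) n := by
  have hunit (i : ℕ) : IsUnit (S i).leadingCoeff := (leadingCoeff_ne_zero.2 (S.ne_zero i)).isUnit
  have hlow (p : K[X]) (hp : p.degree < n) : L (p * S n) = 0 := by
    have hker : degreeLT K n ≤ LinearMap.ker (L ∘ₗ LinearMap.mulRight K (S n)) := by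
      rw [← S.span_degreeLT fun i _ => hunit i, Submodule.span_le]
      rintro _ ⟨m, hm, rfl⟩
      exact horth m hm
    exact hker (mem_degreeLT.2 hp)
  refine ⟨hlow, fun h0 => hsq ?_⟩
  have hlead : S n = (S n).eraseLead + C (S n).leadingCoeff * X ^ n := by
    conv_lhs => rw [← eraseLead_add_C_mul_X_pow (S n), S.natDegree_eq]
  have herase : (S n).eraseLead.degree < n :=
    (degree_eraseLead_lt (S.ne_zero n)).trans_eq (S.degree_eq n)
  rw [show S n * S n = (S n).eraseLead * S n + (S n).leadingCoeff • (X ^ n * S n) by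
      rw [smul_eq_C_mul, ← mul_assoc, ← add_mul, ← hlead],
    map_add, hlow _ herase, map_smul, h0, smul_zero, add_zero]

/-! ### Sign changes -/

theorem const_sign_on_Ioo_of_no_root {a b : ℝ} {Q : ℝ[X]} (hQ : ∀ r ∈ Set.Ioo a b, ¬Q.IsRoot r) :
    (∀ x ∈ Set.Ioo a b, 0 ≤ Q.eval x) ∨ ∀ x ∈ Set.Ioo a b, Q.eval x ≤ 0 := by
  by_contra! hsign
  obtain ⟨⟨x, hx, hx0⟩, ⟨y, hy, hy0⟩⟩ := hsign
  obtain ⟨z, hz, hz0⟩ := isPreconnected_Ioo.intermediate_value hx hy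
    Q.continuous.continuousOn ⟨hx0.le, hy0.le⟩
  exact hQ z hz hz0

theorem exists_finset_roots_const_sign (a b : ℝ) {Q : ℝ[X]} (hQ : Q ≠ 0) :
    ∃ s : Finset ℝ, (∀ x ∈ s, x ∈ Set.Ioo a b ∧ Q.IsRoot x) ∧
      ((∀ x ∈ Set.Ioo a b, 0 ≤ (Q * ∏ r ∈ s, (X - C r)).eval x) ∨
        ∀ x ∈ Set.Ioo a b, (Q * ∏ r ∈ s, (X - C r)).eval x ≤ 0) := by
  induction hd : Q.natDegree using Nat.strong_induction_on generalizing Q with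
  | _ d ih =>
  subst hd
  by_cases hroot : ∃ r ∈ Set.Ioo a b, Q.IsRoot r
  swap
  · push Not at hroot
    exact ⟨∅, by simp, by simpa using const_sign_on_Ioo_of_no_root hroot⟩
  obtain ⟨r, hr, hQr⟩ := hroot
  obtain ⟨R, rfl⟩ := dvd_iff_isRoot.2 hQr
  have hR : R ≠ 0 := right_ne_zero_of_mul hQ
  have hdeg : R.natDegree < ((X - C r) * R).natDegree := by
    rw [natDegree_mul (X_sub_C_ne_zero r) hR, natDegree_X_sub_C]
    omega
  obtain ⟨s, hs, hsign⟩ := ih _ hdeg hR rfl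
  have hs' : ∀ x ∈ s, x ∈ Set.Ioo a b ∧ ((X - C r) * R).IsRoot x := fun x hx =>
    ⟨(hs x hx).1, root_mul_left_of_isRoot _ (hs x hx).2⟩
  -- A root of `R` becomes a double root at `r`, so the sign change at `r` disappears.
  by_cases hrs : r ∈ s
  · refine ⟨s.erase r, fun x hx => hs' x (Finset.mem_of_mem_erase hx), ?_⟩
    rwa [mul_comm (X - C r), mul_assoc, Finset.mul_prod_erase s (fun r => X - C r) hrs]
  · refine ⟨insert r s, Finset.forall_mem_insert _ _ _ |>.2 ⟨⟨hr, hQr⟩, hs'⟩, ?_⟩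
    have heval (x : ℝ) : ((X - C r) * R * ∏ r ∈ insert r s, (X - C r)).eval x =
        (x - r) ^ 2 * (R * ∏ r ∈ s, (X - C r)).eval x := by
      rw [Finset.prod_insert hrs]
      simp only [eval_mul, eval_sub, eval_X, eval_C]
      ring
    simp only [heval]
    exact hsign.imp (fun h x hx => mul_nonneg (sq_nonneg _) (h x hx))
      fun h x hx => mul_nonpos_of_nonneg_of_nonpos (sq_nonneg _) (h x hx)

theorem nonneg_on_Icc_of_nonneg_on_Ioo {a b : ℝ} (hab : a < b) {p : ℝ[X]}
    (hp : ∀ x ∈ Set.Ioo a b, 0 ≤ p.eval x) : ∀ x ∈ Set.Icc a b, 0 ≤ p.eval x := by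
  rw [← closure_Ioo hab.ne]
  exact fun x hx => closure_minimal hp (isClosed_Ici.preimage p.continuous) hx

theorem HasOrthogonalityOrder.hasAtLeastZeros {a b : ℝ} (hab : a < b) {L : ℝ[X] →ₗ[ℝ] ℝ}
    (hL : ∀ p : ℝ[X], p ≠ 0 → (∀ x ∈ Set.Icc a b, 0 ≤ p.eval x) → 0 < L p)
    {Q : ℝ[X]} {d : ℕ} (hQ : HasOrthogonalityOrder L Q d) : HasAtLeastZeros Q d a b := by
  have hQ0 : Q ≠ 0 := by
    rintro rfl
    exact hQ.ne_zero (by rw [mul_zero, map_zero])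
  obtain ⟨s, hs, hsign⟩ := exists_finset_roots_const_sign a b hQ0
  refine ⟨s, ?_, hs⟩
  by_contra! hcard
  have horth : L (Q * ∏ r ∈ s, (X - C r)) = 0 := by
    rw [mul_comm]
    refine hQ.eq_zero _ ?_
    rw [degree_prod, Finset.sum_congr rfl fun r _ => degree_X_sub_C r, Finset.sum_const,
      nsmul_one]
    exact_mod_cast hcard
  have hne : Q * ∏ r ∈ s, (X - C r) ≠ 0 :=
    mul_ne_zero hQ0 (Finset.prod_ne_zero_iff.2 fun r _ => X_sub_C_ne_zero r)
  rcases hsign with hpos | hneg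
  · exact (hL _ hne (nonneg_on_Icc_of_nonneg_on_Ioo hab hpos)).ne' horth
  · have hL_neg := hL _ (neg_ne_zero.2 hne) (nonneg_on_Icc_of_nonneg_on_Ioo hab fun x hx => by
      rw [eval_neg]; exact neg_nonneg.2 (hneg x hx))
    rw [map_neg, horth, neg_zero] at hL_neg
    exact hL_neg.false

/-! ### Jackson integrals against a weight -/

section Jackson

variable {q a b : ℝ} {w : ℝ → ℝ}

theorem mul_pow_mem_Icc (hq0 : 0 ≤ q) (hq1 : q ≤ 1) (ha : a ≤ 0) (hb : 0 ≤ b) {x : ℝ}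
    (hx : x ∈ Set.Icc a b) (j : ℕ) : x * q ^ j ∈ Set.Icc a b := by
  simpa [mul_comm] using (convex_Icc a b).smul_mem_of_zero_mem ⟨ha, hb⟩ hx
    ⟨pow_nonneg hq0 j, pow_le_one₀ hq0 hq1⟩

theorem tendsto_eval_mul_pow (hq0 : 0 ≤ q) (hq1 : q < 1) (p : ℝ[X]) (x : ℝ) :
    Tendsto (fun j : ℕ => p.eval (x * q ^ j)) atTop (𝓝 (p.eval 0)) := by
  refine (p.continuous.tendsto 0).comp ?_
  simpa only [mul_zero] using (tendsto_pow_atTop_nhds_zero_of_lt_one hq0 hq1).const_mul x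

theorem summable_eval_mul_of_tendsto (hq0 : 0 ≤ q) (hq1 : q < 1) {x l : ℝ}
    (hw : Tendsto (fun j : ℕ => w (x * q ^ j)) atTop (𝓝 l)) (p : ℝ[X]) :
    Summable fun j : ℕ => p.eval (x * q ^ j) * w (x * q ^ j) * q ^ j := by
  have hbounded := ((tendsto_eval_mul_pow hq0 hq1 p x).mul hw).isBigO_one ℝ
  refine summable_of_isBigO_nat (summable_geometric_of_lt_one hq0 hq1) ?_
  simpa only [one_mul] using hbounded.mul (Asymptotics.isBigO_refl (fun j : ℕ => q ^ j) atTop)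

/-- The linear functional `p ↦ ∫_a^b p(x) w(x) d_q x` on polynomials. -/
noncomputable def qFunctional (q a b : ℝ) (w : ℝ → ℝ)
    (hw : ∀ p : ℝ[X], QIntegrable q a b fun x => p.eval x * w x) : ℝ[X] →ₗ[ℝ] ℝ where
  toFun p := qIntegral q a b fun x => p.eval x * w x
  map_add' p₁ p₂ := by
    simp only [qIntegral, eval_add, add_mul]
    rw [(hw p₁).1.tsum_add (hw p₂).1, (hw p₁).2.tsum_add (hw p₂).2]
    ring
  map_smul' r p := by
    simp only [qIntegral, eval_smul, smul_eq_mul, mul_assoc, tsum_mul_left, RingHom.id_apply]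
    ring

theorem exists_eval_mul_pow_ne_zero (hq0 : 0 < q) (hq1 : q < 1) {p : ℝ[X]} (hp : p ≠ 0) {x : ℝ}
    (hx : x ≠ 0) : ∃ j : ℕ, p.eval (x * q ^ j) ≠ 0 := by
  by_contra! hroot
  refine hp (p.eq_zero_of_infinite_isRoot
    (Set.infinite_of_injective_forall_mem (f := fun j : ℕ => x * q ^ j) (fun i j hij => ?_) hroot))
  exact (pow_right_strictAnti₀ hq0 hq1).injective (mul_left_cancel₀ hx hij)

theorem qFunctional_pos (hq0 : 0 < q) (hq1 : q < 1) (ha : a ≤ 0) (hb : 0 < b)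
    (hw : ∀ p : ℝ[X], QIntegrable q a b fun x => p.eval x * w x)
    (hw_pos : ∀ x ∈ Set.Icc a b, 0 < w x) {p : ℝ[X]} (hp : p ≠ 0)
    (hp_nonneg : ∀ x ∈ Set.Icc a b, 0 ≤ p.eval x) : 0 < qFunctional q a b w hw p := by
  have hmem {x : ℝ} (hx : x ∈ Set.Icc a b) := mul_pow_mem_Icc hq0.le hq1.le ha hb.le hx
  have hterm {x : ℝ} (hx : x ∈ Set.Icc a b) (j : ℕ) :
      0 ≤ p.eval (x * q ^ j) * w (x * q ^ j) * q ^ j :=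
    mul_nonneg (mul_nonneg (hp_nonneg _ (hmem hx j)) (hw_pos _ (hmem hx j)).le)
      (pow_pos hq0 j).le
  have ha_mem : a ∈ Set.Icc a b := ⟨le_rfl, ha.trans hb.le⟩
  have hb_mem : b ∈ Set.Icc a b := ⟨ha.trans hb.le, le_rfl⟩
  obtain ⟨j, hj⟩ := exists_eval_mul_pow_ne_zero hq0 hq1 hp hb.ne'
  have hj_pos : 0 < p.eval (b * q ^ j) := (hp_nonneg _ (hmem hb_mem j)).lt_of_ne' hj
  have hsum_b : 0 < ∑' j : ℕ, p.eval (b * q ^ j) * w (b * q ^ j) * q ^ j :=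
    (hw p).2.tsum_pos (hterm hb_mem) j
      (mul_pos (mul_pos hj_pos (hw_pos _ (hmem hb_mem j))) (pow_pos hq0 j))
  have hsum_a : 0 ≤ ∑' j : ℕ, p.eval (a * q ^ j) * w (a * q ^ j) * q ^ j :=
    tsum_nonneg (hterm ha_mem)
  have hq : 0 < 1 - q := sub_pos.2 hq1
  refine sub_pos.2 (lt_of_le_of_lt ?_ (mul_pos (mul_pos hb hq) hsum_b))
  exact mul_nonpos_of_nonpos_of_nonneg (mul_nonpos_of_nonpos_of_nonneg ha hq.le) hsum_a

/-- Telescoping over one half of the lattice: with `φ(x₀) = 0` there is no boundary term at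
`j = 0`, and the limit of the boundary terms depends on `x₀` only through `l`. -/
theorem tsum_eq_of_pearson (hq0 : 0 < q) (hq1 : q < 1) {x₀ l : ℝ} (hx₀ : x₀ ≠ 0)
    (hw : Tendsto (fun j : ℕ => w (x₀ * q * q ^ j)) atTop (𝓝 l)) {φ ψ V W : ℝ[X]}
    (hφ : φ.eval x₀ = 0)
    (hpearson : ∀ j : ℕ, ψ.eval (x₀ * q * q ^ j) * w (x₀ * q * q ^ j) =
      φ.eval (x₀ * q * q ^ j) * w (x₀ * q * q ^ j * q))
    (hW : ∀ y ≠ 0, y * W.eval (y * q) = ψ.eval (y * q) * V.eval (y * q) - φ.eval y * V.eval y) :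
    x₀ * ∑' j : ℕ, W.eval (x₀ * q * q ^ j) * w (x₀ * q * q ^ j) * q ^ j =
      (φ * V).eval 0 * l := by
  let Z : ℕ → ℝ := fun j => (φ * V).eval (x₀ * q ^ j) * w (x₀ * q * q ^ j)
  have hZ : Tendsto Z atTop (𝓝 ((φ * V).eval 0 * l)) :=
    (tendsto_eval_mul_pow hq0.le hq1 (φ * V) x₀).mul hw
  have hZ_zero : Z 0 = 0 := by
    simp only [Z, pow_zero, mul_one, eval_mul, hφ, zero_mul]
  have hstep (j : ℕ) :
      x₀ * (W.eval (x₀ * q * q ^ j) * w (x₀ * q * q ^ j) * q ^ j) = Z (j + 1) - Z j := by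
    have hy := hW (x₀ * q ^ j) (mul_ne_zero hx₀ (pow_ne_zero j hq0.ne'))
    simp only [Z, eval_mul, pow_succ, ← mul_assoc] at hy ⊢
    have hp := hpearson j
    rw [mul_right_comm x₀ q] at hp ⊢
    linear_combination w (x₀ * q ^ j * q) * hy + V.eval (x₀ * q ^ j * q) * hp
  rw [← tsum_mul_left]
  refine ((((summable_eval_mul_of_tendsto hq0.le hq1 hw W).mul_left x₀).hasSum_iff_tendsto_nat).2
    ?_).tsum_eq
  simpa only [hstep, Finset.sum_range_sub, hZ_zero, sub_zero] using hZ

theorem qFunctional_eq_zero_of_pearson (hq0 : 0 < q) (hq1 : q < 1) (ha : a ≠ 0) (hb : b ≠ 0)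
    (hw : ∀ p : ℝ[X], QIntegrable q (a * q) (b * q) fun x => p.eval x * w x) {l : ℝ}
    (hw_lim : ∀ x₀ ∈ ({a, b} : Set ℝ), Tendsto (fun j : ℕ => w (x₀ * q * q ^ j)) atTop (𝓝 l))
    {φ ψ V W : ℝ[X]} (hφ : ∀ x₀ ∈ ({a, b} : Set ℝ), φ.eval x₀ = 0)
    (hpearson : ∀ x₀ ∈ ({a, b} : Set ℝ), ∀ j : ℕ,
      ψ.eval (x₀ * q * q ^ j) * w (x₀ * q * q ^ j) =
        φ.eval (x₀ * q * q ^ j) * w (x₀ * q * q ^ j * q))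
    (hW : ∀ y ≠ 0, y * W.eval (y * q) = ψ.eval (y * q) * V.eval (y * q) - φ.eval y * V.eval y) :
    qFunctional q (a * q) (b * q) w hw W = 0 := by
  have half (x₀ : ℝ) (hx : x₀ ∈ ({a, b} : Set ℝ)) (hx₀ : x₀ ≠ 0) :=
    tsum_eq_of_pearson hq0 hq1 hx₀ (hw_lim x₀ hx) (hφ x₀ hx) (hpearson x₀ hx) hW
  change b * q * (1 - q) * _ - a * q * (1 - q) * _ = 0
  linear_combination q * (1 - q) * half b (by simp) hb - q * (1 - q) * half a (by simp) ha

end Jackson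

/-! ### The weight -/

section InfiniteQPochhammer

variable {q : ℝ} (hq0 : 0 < q) (hq1 : q < 1)
include hq0 hq1

theorem one_sub_mul_pow_pos {a : ℝ} (ha : a < 1) (j : ℕ) : 0 < 1 - a * q ^ j := by
  have hpow : q ^ j ≤ 1 := pow_le_one₀ hq0.le hq1.le
  nlinarith [pow_pos hq0 j]

theorem multipliable_one_sub_mul_pow (a : ℝ) : Multipliable fun j : ℕ => 1 - a * q ^ j := by
  simpa only [sub_eq_add_neg] using Real.multipliable_one_add_of_summable
    ((summable_geometric_of_lt_one hq0.le hq1).mul_left a).neg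

theorem tendsto_qPoch (a : ℝ) : Tendsto (qPoch q a) atTop (𝓝 (qPochInf q a)) :=
  (multipliable_one_sub_mul_pow hq0 hq1 a).tendsto_prod_tprod_nat

theorem qPochInf_eq_qPoch_mul (a : ℝ) (n : ℕ) :
    qPochInf q a = qPoch q a n * qPochInf q (a * q ^ n) := by
  refine tendsto_nhds_unique ((tendsto_add_atTop_iff_nat n).2 (tendsto_qPoch hq0 hq1 a)) ?_
  simpa only [add_comm _ n, qPoch_add] using
    (tendsto_qPoch hq0 hq1 (a * q ^ n)).const_mul (qPoch q a n)

theorem qPochInf_eq_one_sub_mul (a : ℝ) : qPochInf q a = (1 - a) * qPochInf q (a * q) := by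
  rw [qPochInf_eq_qPoch_mul hq0 hq1 a 1, qPoch_succ', qPoch_zero, mul_one, pow_one]

theorem qPoch_pos {a : ℝ} (ha : a < 1) (n : ℕ) : 0 < qPoch q a n :=
  Finset.prod_pos fun j _ => one_sub_mul_pow_pos hq0 hq1 ha j

theorem qPochInf_pos {a : ℝ} (ha : a < 1) : 0 < qPochInf q a := by
  refine lt_of_le_of_ne'
    (ge_of_tendsto' (tendsto_qPoch hq0 hq1 a) fun n => (qPoch_pos hq0 hq1 ha n).le) ?_
  have hsum : Summable fun j : ℕ => ‖-(a * q ^ j)‖ :=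
    ((summable_geometric_of_lt_one hq0.le hq1).mul_left a).neg.norm
  simpa only [qPochInf, sub_eq_add_neg] using tprod_one_add_ne_zero_of_summable
    (fun j => by
      rw [← sub_eq_add_neg]
      exact (one_sub_mul_pow_pos hq0 hq1 ha j).ne') hsum

theorem tendsto_qPochInf_mul_pow {a : ℝ} (ha : a < 1) :
    Tendsto (fun n : ℕ => qPochInf q (a * q ^ n)) atTop (𝓝 1) := by
  have hne : qPochInf q a ≠ 0 := (qPochInf_pos hq0 hq1 ha).ne'
  have hquot : (fun n : ℕ => qPochInf q (a * q ^ n)) = fun n => qPochInf q a / qPoch q a n := by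
    ext n
    rw [eq_div_iff (qPoch_pos hq0 hq1 ha n).ne', qPochInf_eq_qPoch_mul hq0 hq1 a n, mul_comm]
  rw [hquot, ← div_self hne]
  exact tendsto_const_nhds.div (tendsto_qPoch hq0 hq1 a) hne

end InfiniteQPochhammer

/-- The range of the parameters for which the big `q`-Jacobi polynomials are orthogonal with
respect to the positive weight `bigQJacobiWeight`. -/
structure BigQJacobiParams (q α β γ : ℝ) : Prop where
  q_pos : 0 < q
  q_lt_one : q < 1
  α_pos : 0 < α
  α_mul_lt_one : α * q < 1
  β_nonneg : 0 ≤ β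
  β_mul_lt_one : β * q < 1
  γ_neg : γ < 0

namespace BigQJacobiParams

variable {q α β γ : ℝ} (h : BigQJacobiParams q α β γ)
include h

theorem γ_mul_neg : γ * q < 0 := mul_neg_of_neg_of_pos h.γ_neg h.q_pos

theorem α_mul_pos : 0 < α * q := mul_pos h.α_pos h.q_pos

theorem γ_mul_lt_α_mul : γ * q < α * q := h.γ_mul_neg.trans h.α_mul_pos

theorem mul_q_mem_Icc {x₀ : ℝ} (hx₀ : x₀ ∈ ({γ, α} : Set ℝ)) :
    x₀ * q ∈ Set.Icc (γ * q) (α * q) := by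
  rcases hx₀ with rfl | rfl
  exacts [⟨le_rfl, h.γ_mul_lt_α_mul.le⟩, ⟨h.γ_mul_lt_α_mul.le, le_rfl⟩]

section Weight

variable {x : ℝ} (hx : x ∈ Set.Icc (γ * q) (α * q))
include hx

theorem lt_one : x < 1 := hx.2.trans_lt h.α_mul_lt_one

theorem inv_α_mul_lt_one : α⁻¹ * x < 1 := by
  rw [inv_mul_lt_one₀ h.α_pos]
  exact hx.2.trans_lt (mul_lt_of_lt_one_right h.α_pos h.q_lt_one)

theorem inv_γ_mul_le : γ⁻¹ * x ≤ q := by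
  rw [← div_eq_inv_mul, div_le_iff_of_neg h.γ_neg, mul_comm]
  exact hx.1

theorem β_mul_inv_γ_mul_lt_one : β * γ⁻¹ * x < 1 := by
  rw [mul_assoc]
  exact (mul_le_mul_of_nonneg_left (h.inv_γ_mul_le hx) h.β_nonneg).trans_lt h.β_mul_lt_one

theorem weight_pos : 0 < bigQJacobiWeight q α β γ x := by
  have hpos {a : ℝ} (ha : a < 1) : 0 < qPochInf q a := qPochInf_pos h.q_pos h.q_lt_one ha
  exact div_pos
    (mul_pos (hpos (h.inv_α_mul_lt_one hx)) (hpos ((h.inv_γ_mul_le hx).trans_lt h.q_lt_one)))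
    (mul_pos (hpos (h.lt_one hx)) (hpos (h.β_mul_inv_γ_mul_lt_one hx)))

theorem tendsto_weight :
    Tendsto (fun j : ℕ => bigQJacobiWeight q α β γ (x * q ^ j)) atTop (𝓝 1) := by
  have hlim {a : ℝ} (ha : a < 1) := tendsto_qPochInf_mul_pow h.q_pos h.q_lt_one ha
  have hquot :=
    ((hlim (h.inv_α_mul_lt_one hx)).mul (hlim ((h.inv_γ_mul_le hx).trans_lt h.q_lt_one))).div
      ((hlim (h.lt_one hx)).mul (hlim (h.β_mul_inv_γ_mul_lt_one hx)))
      (mul_ne_zero one_ne_zero one_ne_zero)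
  simpa only [bigQJacobiWeight, Pi.div_def, mul_assoc, mul_one, div_one] using hquot

theorem weight_pearson :
    α * (1 - x) * (γ - β * x) * bigQJacobiWeight q α β γ x =
      (α - x) * (γ - x) * bigQJacobiWeight q α β γ (x * q) := by
  have hα : α * (1 - α⁻¹ * x) = α - x := by rw [mul_sub, mul_inv_cancel_left₀ h.α_pos.ne', mul_one]
  have hγ : γ * (1 - γ⁻¹ * x) = γ - x := by rw [mul_sub, mul_inv_cancel_left₀ h.γ_neg.ne, mul_one]
  have hβ : γ * (1 - β * γ⁻¹ * x) = γ - β * x := by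
    have hcancel := mul_inv_cancel₀ h.γ_neg.ne
    linear_combination -(β * x) * hcancel
  have hne {a : ℝ} (ha : a < 1) : (1 - a) * qPochInf q (a * q) ≠ 0 := by
    rw [← qPochInf_eq_one_sub_mul h.q_pos h.q_lt_one]
    exact (qPochInf_pos h.q_pos h.q_lt_one ha).ne'
  obtain ⟨hx_ne, hA_ne⟩ := mul_ne_zero_iff.1 (hne (h.lt_one hx))
  obtain ⟨hβ_ne, hB_ne⟩ := mul_ne_zero_iff.1 (hne (h.β_mul_inv_γ_mul_lt_one hx))
  simp only [← hα, ← hβ, ← hγ, bigQJacobiWeight, ← mul_assoc]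
  have hstep (a : ℝ) := qPochInf_eq_one_sub_mul h.q_pos h.q_lt_one a
  rw [hstep (α⁻¹ * x), hstep (γ⁻¹ * x), hstep x, hstep (β * γ⁻¹ * x)]
  generalize qPochInf q (β * γ⁻¹ * x * q) = B, qPochInf q (x * q) = A,
    1 - β * γ⁻¹ * x = u, 1 - x = v at hx_ne hA_ne hβ_ne hB_ne ⊢
  field_simp

end Weight

theorem qIntegrable (p : ℝ[X]) :
    QIntegrable q (γ * q) (α * q) fun x => p.eval x * bigQJacobiWeight q α β γ x :=
  ⟨summable_eval_mul_of_tendsto h.q_pos.le h.q_lt_one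
      (h.tendsto_weight (h.mul_q_mem_Icc (by simp))) p,
    summable_eval_mul_of_tendsto h.q_pos.le h.q_lt_one
      (h.tendsto_weight (h.mul_q_mem_Icc (by simp))) p⟩

/-- Integration of polynomials against the big `q`-Jacobi weight. -/
noncomputable def functional : ℝ[X] →ₗ[ℝ] ℝ :=
  qFunctional q (γ * q) (α * q) (bigQJacobiWeight q α β γ) h.qIntegrable

theorem functional_pos {p : ℝ[X]} (hp : p ≠ 0)
    (hp_nonneg : ∀ x ∈ Set.Icc (γ * q) (α * q), 0 ≤ p.eval x) : 0 < h.functional p :=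
  qFunctional_pos h.q_pos h.q_lt_one h.γ_mul_neg.le h.α_mul_pos h.qIntegrable
    (fun _ hx => h.weight_pos hx) hp hp_nonneg

end BigQJacobiParams

/-! ### The `q`-difference equation -/

/-- The value at `x = yq` of the `q`-difference operator
`f ↦ aq(x-1)(bx-c)(f(qx) - f(x)) + (x-aq)(x-cq)(f(x/q) - f(x))` of the big `q`-Jacobi
polynomials. The substitution keeps `x/q` polynomial in the variable. -/
noncomputable def bigQJacobiOperator (q a b c y : ℝ) : ℝ[X] →ₗ[ℝ] ℝ :=
  (a * q * (y * q - 1) * (b * (y * q) - c)) • (leval (y * q * q) - leval (y * q)) +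
    ((y * q - a * q) * (y * q - c * q)) • (leval y - leval (y * q))

/-- The eigenvalue of the `q`-difference operator at the polynomial of degree `n`. -/
noncomputable def bigQJacobiEigenvalue (q a b : ℝ) (n : ℕ) : ℝ :=
  (q ^ n)⁻¹ * (1 - q ^ n) * (1 - a * b * q ^ (n + 1))

/-- The operator maps `(x; q)_i` to `x²` times a combination of `(x; q)_i` and `(x; q)_{i-1}`;
this is the coefficient of the latter, up to sign. -/
noncomputable def bigQJacobiLowering (q a c : ℝ) (i : ℕ) : ℝ :=
  (q ^ i)⁻¹ * (1 - q ^ i) * (1 - a * q ^ i) * (1 - c * q ^ i)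

section QDifference

variable {q a b c : ℝ}

theorem bigQJacobiOperator_apply (q a b c y : ℝ) (p : ℝ[X]) :
    bigQJacobiOperator q a b c y p =
      a * q * (y * q - 1) * (b * (y * q) - c) * (p.eval (y * q * q) - p.eval (y * q)) +
        (y * q - a * q) * (y * q - c * q) * (p.eval y - p.eval (y * q)) := by
  simp only [bigQJacobiOperator, LinearMap.add_apply, LinearMap.smul_apply, LinearMap.sub_apply,
    leval_apply, smul_eq_mul]

theorem bigQJacobiEigenvalue_sub (hq : q ≠ 0) (a b : ℝ) (i n : ℕ) :
    bigQJacobiEigenvalue q a b i - bigQJacobiEigenvalue q a b n =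
      (q ^ i)⁻¹ * (1 - (q ^ n)⁻¹ * q ^ i) * (1 - a * b * q ^ (n + 1 + i)) := by
  have hi : q ^ i ≠ 0 := pow_ne_zero i hq
  have hn : q ^ n ≠ 0 := pow_ne_zero n hq
  simp only [bigQJacobiEigenvalue, pow_add]
  field_simp
  ring

theorem bigQJacobiOperator_qPoch_zero (y : ℝ) :
    bigQJacobiOperator q a b c y (qPoch (C q) X 0) = 0 := by
  simp only [bigQJacobiOperator_apply, qPoch_zero, eval_one, sub_self, mul_zero, add_zero]

theorem bigQJacobiOperator_qPoch_succ (hq : q ≠ 0) (y : ℝ) (i : ℕ) :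
    bigQJacobiOperator q a b c y (qPoch (C q) X (i + 1)) =
      (y * q) ^ 2 * (bigQJacobiEigenvalue q a b (i + 1) * qPoch q (y * q) (i + 1) -
        bigQJacobiLowering q a c (i + 1) * qPoch q (y * q) i) := by
  have hshift : (1 - y * q) * qPoch q (y * q * q) i =
      qPoch q (y * q) i * (1 - y * q * q ^ i) := by
    rw [← qPoch_succ', qPoch_succ]
  have hpow : q ^ (i + 1) ≠ 0 := pow_ne_zero _ hq
  have hcancel : q ^ (i + 1) * (q ^ (i + 1))⁻¹ = 1 := mul_inv_cancel₀ hpow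
  simp only [bigQJacobiOperator_apply, qPoch_eval, bigQJacobiEigenvalue, bigQJacobiLowering]
  rw [qPoch_succ' q y, qPoch_succ q (y * q * q), qPoch_succ q (y * q)]
  refine mul_left_cancel₀ hpow ?_
  linear_combination
    (-q ^ (i + 1) * (a * q) * (b * (y * q) - c) * (1 - y * q * q * q ^ i)) * hshift -
    (y * q) ^ 2 * (1 - q ^ (i + 1)) * qPoch q (y * q) i *
      ((1 - a * b * q ^ (i + 1 + 1)) * (1 - y * q * q ^ i) -
        (1 - a * q ^ (i + 1)) * (1 - c * q ^ (i + 1))) * hcancel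

theorem bigQJacobiCoeff_succ_mul_lowering (hq0 : 0 < q) (hq1 : q < 1) {n i : ℕ} (hi : i < n)
    (h : BigQJacobiRegular q a b c n) :
    bigQJacobiCoeff q a b c n (i + 1) * bigQJacobiLowering q a c (i + 1) =
      (bigQJacobiEigenvalue q a b i - bigQJacobiEigenvalue q a b n) *
        bigQJacobiCoeff q a b c n i := by
  obtain ⟨d, rfl⟩ := Nat.exists_eq_add_of_lt hi
  have hpow : 1 - q ^ (i + 1) ≠ 0 := (sub_pos.2 (pow_lt_one₀ hq0.le hq1 i.succ_ne_zero)).ne'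
  have hab : 1 - a * b * q ^ (i + d + 1 + 1 + i) ≠ 0 :=
    h.one_sub_ne_zero (by omega) (by omega)
  have hfirst (x : ℝ) (r : ℕ) :
      qPoch q (x * q ^ r) (d + 1) = (1 - x * q ^ r) * qPoch q (x * q ^ (r + 1)) d := by
    rw [qPoch_succ', mul_assoc, ← pow_succ]
  rw [bigQJacobiEigenvalue_sub hq0.ne', bigQJacobiCoeff, bigQJacobiCoeff, bigQJacobiLowering,
    show i + d + 1 - (i + 1) = d by omega, show i + d + 1 - i = d + 1 by omega,
    hfirst, hfirst, hfirst, qPoch_succ, qPoch_succ q q, ← pow_succ', ← add_assoc _ i 1]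
  generalize (q ^ (i + d + 1))⁻¹ = N
  field_simp

theorem bigQJacobiOperator_partial_sum (hq0 : 0 < q) (hq1 : q < 1) {n : ℕ}
    (h : BigQJacobiRegular q a b c n) (y : ℝ) {m : ℕ} (hm : m ≤ n) :
    bigQJacobiOperator q a b c y
        (∑ i ∈ Finset.range (m + 1), C (bigQJacobiCoeff q a b c n i) * qPoch (C q) X i) =
      (y * q) ^ 2 *
        (bigQJacobiEigenvalue q a b n *
            ∑ i ∈ Finset.range (m + 1), bigQJacobiCoeff q a b c n i * qPoch q (y * q) i +
          (bigQJacobiEigenvalue q a b m - bigQJacobiEigenvalue q a b n) *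
            bigQJacobiCoeff q a b c n m * qPoch q (y * q) m) := by
  induction m with
  | zero =>
    simp only [zero_add, Finset.sum_range_one, ← smul_eq_C_mul, map_smul,
      bigQJacobiOperator_qPoch_zero, bigQJacobiEigenvalue, pow_zero]
    ring
  | succ m ih =>
    rw [Finset.sum_range_succ, map_add, ih (m.le_succ.trans hm), ← smul_eq_C_mul, map_smul,
      bigQJacobiOperator_qPoch_succ hq0.ne', Finset.sum_range_succ _ (m + 1), smul_eq_mul]
    linear_combination -((y * q) ^ 2 * qPoch q (y * q) m) *
      bigQJacobiCoeff_succ_mul_lowering hq0 hq1 hm h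

theorem bigQJacobiOperator_bigQJacobi (hq0 : 0 < q) (hq1 : q < 1) {n : ℕ}
    (h : BigQJacobiRegular q a b c n) (y : ℝ) :
    bigQJacobiOperator q a b c y (bigQJacobi q a b c n) =
      bigQJacobiEigenvalue q a b n * (y * q) ^ 2 * (bigQJacobi q a b c n).eval (y * q) := by
  rw [bigQJacobi_eq_sum h, bigQJacobiOperator_partial_sum hq0 hq1 h y le_rfl, eval_finsetSum]
  simp only [eval_mul, eval_C, qPoch_eval]
  ring

end QDifference

theorem exists_qWronskian (q : ℝ) (F G : ℝ[X]) :
    ∃ V : ℝ[X], ∀ y : ℝ,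
      G.eval y * F.eval (y * q) - F.eval y * G.eval (y * q) = y * V.eval y := by
  obtain ⟨V, hV⟩ : X ∣ G * F.comp (X * C q) - F * G.comp (X * C q) := by
    rw [X_dvd_iff, coeff_zero_eq_eval_zero]
    simp only [eval_sub, eval_mul, eval_comp, eval_C, eval_X, zero_mul]
    ring
  refine ⟨V, fun y => ?_⟩
  simpa only [eval_sub, eval_mul, eval_comp, eval_C, eval_X] using congrArg (eval y) hV

theorem bigQJacobiOperator_lagrange {q a b c μ ν : ℝ} (hq : q ≠ 0) {F G V : ℝ[X]}
    (hF : ∀ y, bigQJacobiOperator q a b c y F = μ * (y * q) ^ 2 * F.eval (y * q))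
    (hG : ∀ y, bigQJacobiOperator q a b c y G = ν * (y * q) ^ 2 * G.eval (y * q))
    (hV : ∀ y, G.eval y * F.eval (y * q) - F.eval y * G.eval (y * q) = y * V.eval y)
    {y : ℝ} (hy : y ≠ 0) :
    y * ((μ - ν) * (F.eval (y * q) * G.eval (y * q))) =
      a * (1 - y * q) * (c - b * (y * q)) * V.eval (y * q) - (a - y) * (c - y) * V.eval y := by
  refine mul_left_cancel₀ (mul_ne_zero (pow_ne_zero 2 hq) hy) ?_
  have hFy := hF y
  have hGy := hG y
  rw [bigQJacobiOperator_apply] at hFy hGy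
  linear_combination (-G.eval (y * q)) * hFy + F.eval (y * q) * hGy +
    a * q * (y * q - 1) * (b * (y * q) - c) * hV (y * q) -
    (y * q - a * q) * (y * q - c * q) * hV y

namespace BigQJacobiParams

variable {q α β γ : ℝ} (h : BigQJacobiParams q α β γ)
include h

theorem functional_mul_eq_zero_of_eigenvalue_ne {μ ν : ℝ} (hμν : μ ≠ ν) {F G : ℝ[X]}
    (hF : ∀ y, bigQJacobiOperator q α β γ y F = μ * (y * q) ^ 2 * F.eval (y * q))
    (hG : ∀ y, bigQJacobiOperator q α β γ y G = ν * (y * q) ^ 2 * G.eval (y * q)) :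
    h.functional (F * G) = 0 := by
  obtain ⟨V, hV⟩ := exists_qWronskian q F G
  let φ : ℝ[X] := (C α - X) * (C γ - X)
  let ψ : ℝ[X] := C α * (1 - X) * (C γ - C β * X)
  have hφ (x : ℝ) : φ.eval x = (α - x) * (γ - x) := by
    simp only [φ, eval_mul, eval_sub, eval_C, eval_X]
  have hψ (x : ℝ) : ψ.eval x = α * (1 - x) * (γ - β * x) := by
    simp only [ψ, eval_mul, eval_sub, eval_C, eval_X, eval_one]
  have hzero : h.functional ((μ - ν) • (F * G)) = 0 := by
    refine qFunctional_eq_zero_of_pearson h.q_pos h.q_lt_one h.γ_neg.ne h.α_pos.ne' h.qIntegrable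
      (φ := φ) (ψ := ψ) (V := V) (fun x₀ hx₀ => h.tendsto_weight (h.mul_q_mem_Icc hx₀)) ?_
      (fun x₀ hx₀ j => ?_) fun y hy => ?_
    · rintro _ (rfl | rfl) <;> rw [hφ, sub_self] <;> simp only [mul_zero, zero_mul]
    · rw [hφ, hψ]
      exact h.weight_pearson (mul_pow_mem_Icc h.q_pos.le h.q_lt_one.le h.γ_mul_neg.le
        h.α_mul_pos.le (h.mul_q_mem_Icc hx₀) j)
    · rw [hφ, hψ, eval_smul, eval_mul, smul_eq_mul]
      exact bigQJacobiOperator_lagrange h.q_pos.ne' hF hG hV hy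
  rw [map_smul, smul_eq_mul] at hzero
  exact (mul_eq_zero.1 hzero).resolve_left (sub_ne_zero.2 hμν)

theorem mul_pow_ne_one {x : ℝ} (hx : x < 1) (j : ℕ) : x * q ^ j ≠ 1 :=
  (sub_pos.1 (one_sub_mul_pow_pos h.q_pos h.q_lt_one hx j)).ne

theorem α_mul_β_mul_lt_one : α * q * (β * q) < 1 :=
  mul_lt_one_of_nonneg_of_lt_one_left h.α_mul_pos.le h.α_mul_lt_one h.β_mul_lt_one.le

theorem α_mul_β_mul_pow_ne_one {j : ℕ} (hj : 2 ≤ j) : α * β * q ^ j ≠ 1 := by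
  obtain ⟨j, rfl⟩ := Nat.exists_eq_add_of_le' hj
  convert h.mul_pow_ne_one h.α_mul_β_mul_lt_one j using 1
  ring

theorem α_div_mul_pow_ne_one {k : ℕ} (hα : ∀ i < k, α ≠ q ^ i) (j : ℕ) :
    α / q ^ k * q ^ (j + 1) ≠ 1 := by
  rw [div_mul_eq_mul_div, Ne, div_eq_one_iff_eq (pow_pos h.q_pos k).ne']
  rcases le_or_gt k j with hkj | hjk
  · obtain ⟨d, rfl⟩ := Nat.exists_eq_add_of_le' hkj
    rw [pow_succ', ← mul_assoc, pow_add, ← mul_assoc]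
    exact fun heq => h.mul_pow_ne_one h.α_mul_lt_one d
      (mul_right_cancel₀ (pow_pos h.q_pos k).ne' (heq.trans (one_mul _).symm))
  · obtain ⟨d, rfl⟩ := Nat.exists_eq_add_of_lt hjk
    rw [show j + d + 1 = d + (j + 1) by omega, pow_add q d]
    exact fun heq => hα d (by omega) (mul_right_cancel₀ (pow_pos h.q_pos _).ne' heq)

theorem γ_div_mul_pow_ne_one (l j : ℕ) : γ / q ^ l * q ^ j ≠ 1 :=
  ((mul_neg_of_neg_of_pos (div_neg_of_neg_of_pos h.γ_neg (pow_pos h.q_pos l))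
    (pow_pos h.q_pos j)).trans one_pos).ne

theorem β_div_mul_pow_ne_one {m j : ℕ} (hmj : m < j) : β / q ^ m * q ^ j ≠ 1 := by
  obtain ⟨d, rfl⟩ := Nat.exists_eq_add_of_lt hmj
  rw [show m + d + 1 = m + (d + 1) by omega, pow_add, ← mul_assoc,
    div_mul_cancel₀ _ (pow_pos h.q_pos m).ne', pow_succ', ← mul_assoc]
  exact h.mul_pow_ne_one h.β_mul_lt_one d

/-- For `n = 0` the hypothesis `k + l + m ≤ n - 1` reads `k = l = m = 0`. -/
theorem regular {k l m n : ℕ} (hα : ∀ i < k, α ≠ q ^ i) (hn : k + l + m ≤ n - 1) :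
    BigQJacobiRegular q (α / q ^ k) (β / q ^ (l + m)) (γ / q ^ l) n where
  a_ne := h.α_div_mul_pow_ne_one hα
  c_ne j := h.γ_div_mul_pow_ne_one l (j + 1)
  ab_ne j hj hnj := by
    obtain ⟨d, rfl⟩ : ∃ d, j = k + (l + m) + d := Nat.exists_eq_add_of_le (by omega)
    convert h.α_mul_β_mul_pow_ne_one (show 2 ≤ d by omega) using 1
    have hk : q ^ k ≠ 0 := (pow_pos h.q_pos k).ne'
    have hlm : q ^ (l + m) ≠ 0 := (pow_pos h.q_pos (l + m)).ne'
    rw [pow_add q (k + (l + m)), pow_add q k]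
    field_simp

theorem regular_zero (n : ℕ) : BigQJacobiRegular q α β γ n := by
  simpa using h.regular (k := 0) (l := 0) (m := 0) (n := n) (by simp) (Nat.zero_le _)

theorem eigenvalue_injective : Function.Injective (bigQJacobiEigenvalue q α β) := by
  intro m n hmn
  by_contra hne
  rw [← sub_eq_zero, bigQJacobiEigenvalue_sub h.q_pos.ne'] at hmn
  refine mul_ne_zero (mul_ne_zero (inv_ne_zero (pow_pos h.q_pos m).ne') ?_) ?_ hmn
  · exact sub_ne_zero.2 fun heq => hne ((pow_right_strictAnti₀ h.q_pos h.q_lt_one).injective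
      ((inv_mul_eq_one₀ (pow_pos h.q_pos n).ne').1 heq.symm).symm)
  · exact sub_ne_zero.2 (h.α_mul_β_mul_pow_ne_one (by omega)).symm

theorem hasOrthogonalityOrder_bigQJacobi (n : ℕ) :
    HasOrthogonalityOrder h.functional (bigQJacobi q α β γ n) n := by
  let S : Sequence ℝ :=
    ⟨bigQJacobi q α β γ, fun i => degree_bigQJacobi h.q_pos h.q_lt_one (h.regular_zero i)⟩
  have heigen (i : ℕ) := bigQJacobiOperator_bigQJacobi h.q_pos h.q_lt_one (h.regular_zero i)
  refine hasOrthogonalityOrder_of_sequence S (fun m hm => ?_) ?_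
  · exact h.functional_mul_eq_zero_of_eigenvalue_ne (h.eigenvalue_injective.ne hm.ne)
      (heigen m) (heigen n)
  · refine (h.functional_pos (mul_ne_zero (S.ne_zero n) (S.ne_zero n)) fun x _ => ?_).ne'
    rw [eval_mul]
    exact mul_self_nonneg _

end BigQJacobiParams

/-! ### Quasi-orthogonality for shifted parameters -/

section ParameterShift

variable {q a b c : ℝ} {n : ℕ}

theorem BigQJacobiRegular.contiguousCoeff_denom_ne_zero
    (h : BigQJacobiRegular q a b c (n + 1)) :
    (1 - a * b * q ^ (2 * n + 2)) * (1 - a * b * q ^ (2 * n + 3)) ≠ 0 :=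
  mul_ne_zero (h.one_sub_ne_zero (by omega) (by omega)) (h.one_sub_ne_zero (by omega) (by omega))

namespace HasOrthogonalityOrder

variable {L : ℝ[X] →ₗ[ℝ] ℝ} {d : ℕ}

theorem bigQJacobi_of_mul_q_left (hq0 : 0 < q) (hq1 : q < 1)
    (h : BigQJacobiRegular q a b c (n + 1)) (ha : a ≠ 0) (hb : b * q ^ (n + 1) ≠ 1)
    (hsucc : HasOrthogonalityOrder L (bigQJacobi q (a * q) b c (n + 1)) (d + 1))
    (hself : HasOrthogonalityOrder L (bigQJacobi q (a * q) b c n) d) :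
    HasOrthogonalityOrder L (bigQJacobi q a b c (n + 1)) d := by
  have hpow : q ^ (n + 1) ≠ 1 := (pow_lt_one₀ hq0.le hq1 n.succ_ne_zero).ne
  rw [bigQJacobi_contiguous_a hq0.ne' h]
  refine hsucc.add_C_mul hself
    (div_ne_zero (neg_ne_zero.2 ?_) h.contiguousCoeff_denom_ne_zero)
  simp only [ne_eq, mul_eq_zero, sub_eq_zero, not_or]
  exact ⟨⟨⟨⟨ha, hq0.ne'⟩, hpow.symm⟩, hb.symm⟩, (h.c_ne n).symm⟩

theorem bigQJacobi_of_mul_q_right (hq0 : 0 < q) (hq1 : q < 1)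
    (h : BigQJacobiRegular q a b c (n + 1)) (ha : a ≠ 0) (hb : b ≠ 0)
    (hsucc : HasOrthogonalityOrder L (bigQJacobi q a (b * q) c (n + 1)) (d + 1))
    (hself : HasOrthogonalityOrder L (bigQJacobi q a (b * q) c n) d) :
    HasOrthogonalityOrder L (bigQJacobi q a b c (n + 1)) d := by
  have hpow : q ^ (n + 1) ≠ 1 := (pow_lt_one₀ hq0.le hq1 n.succ_ne_zero).ne
  rw [bigQJacobi_contiguous_b hq0.ne' h]
  refine hsucc.add_C_mul hself (div_ne_zero ?_ h.contiguousCoeff_denom_ne_zero)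
  simp only [ne_eq, mul_eq_zero, sub_eq_zero, not_or]
  exact ⟨⟨⟨⟨⟨ha, hb⟩, pow_ne_zero _ hq0.ne'⟩, hpow.symm⟩, (h.a_ne n).symm⟩, (h.c_ne n).symm⟩

theorem bigQJacobi_of_mul_q_mul_q (hq0 : 0 < q) (hq1 : q < 1)
    (h : BigQJacobiRegular q a b c (n + 1)) (hc : c ≠ 0) (hab : a * b / c * q ^ (n + 1) ≠ 1)
    (hsucc : HasOrthogonalityOrder L (bigQJacobi q a (b * q) (c * q) (n + 1)) (d + 1))
    (hself : HasOrthogonalityOrder L (bigQJacobi q a (b * q) (c * q) n) d) :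
    HasOrthogonalityOrder L (bigQJacobi q a b c (n + 1)) d := by
  have hshift : a * (b * q) / (c * q) = a * b / c := by
    rw [← mul_assoc, mul_div_mul_right _ _ hq0.ne']
  have hcq : c * q ≠ 0 := mul_ne_zero hc hq0.ne'
  rw [bigQJacobi_swap q a (b * q) hcq, hshift] at hsucc hself
  rw [bigQJacobi_swap q a b hc]
  exact hsucc.bigQJacobi_of_mul_q_left hq0 hq1 (h.swap hc) hc hab hself

end HasOrthogonalityOrder

end ParameterShift

namespace BigQJacobiParams

variable {q α β γ : ℝ} (h : BigQJacobiParams q α β γ)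
include h

theorem div_pow_succ_mul (x : ℝ) (k : ℕ) : x / q ^ (k + 1) * q = x / q ^ k := by
  rw [pow_succ, ← div_div, div_mul_cancel₀ _ h.q_pos.ne']

theorem α_mul_β_div_γ_mul_pow_ne_one (n : ℕ) : α * β / γ * q ^ n ≠ 1 :=
  ((mul_nonpos_of_nonpos_of_nonneg
    (div_nonpos_of_nonneg_of_nonpos (mul_nonneg h.α_pos.le h.β_nonneg) h.γ_neg.le)
    (pow_pos h.q_pos n).le).trans_lt one_pos).ne

theorem hasOrthogonalityOrder_shift_γ (l : ℕ) {d : ℕ} (hd : 0 < d) :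
    HasOrthogonalityOrder h.functional (bigQJacobi q α (β / q ^ l) (γ / q ^ l) (l + d)) d := by
  induction l generalizing d with
  | zero => simpa using h.hasOrthogonalityOrder_bigQJacobi d
  | succ l ih =>
    have hreg : BigQJacobiRegular q α (β / q ^ (l + 1)) (γ / q ^ (l + 1)) (l + d + 1) := by
      simpa using h.regular (k := 0) (l := l + 1) (m := 0) (by simp) (by omega)
    have hquot : α * (β / q ^ (l + 1)) / (γ / q ^ (l + 1)) = α * β / γ := by
      rw [← mul_div_assoc, div_div_div_cancel_right₀ (pow_pos h.q_pos _).ne']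
    rw [add_right_comm l 1 d]
    refine .bigQJacobi_of_mul_q_mul_q h.q_pos h.q_lt_one hreg
      (div_ne_zero h.γ_neg.ne (pow_pos h.q_pos _).ne') ?_ ?_ ?_
    · rw [hquot]
      exact h.α_mul_β_div_γ_mul_pow_ne_one _
    · rw [h.div_pow_succ_mul, h.div_pow_succ_mul]
      exact ih (d := d + 1) d.succ_pos
    · rw [h.div_pow_succ_mul, h.div_pow_succ_mul]
      exact ih hd

theorem hasOrthogonalityOrder_shift_β_γ {m : ℕ} (hβ : m ≠ 0 → β ≠ 0) (l : ℕ) {d : ℕ}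
    (hd : 0 < d) : HasOrthogonalityOrder h.functional
      (bigQJacobi q α (β / q ^ (l + m)) (γ / q ^ l) (l + m + d)) d := by
  induction m generalizing d with
  | zero => exact h.hasOrthogonalityOrder_shift_γ l hd
  | succ m ih =>
    have hβ_ne : β ≠ 0 := hβ m.succ_ne_zero
    have hreg : BigQJacobiRegular q α (β / q ^ (l + (m + 1))) (γ / q ^ l) (l + m + d + 1) := by
      simpa using h.regular (k := 0) (l := l) (m := m + 1) (by simp) (by omega)
    rw [← add_assoc l m 1] at hreg ⊢
    rw [add_right_comm (l + m) 1 d]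
    refine .bigQJacobi_of_mul_q_right h.q_pos h.q_lt_one hreg h.α_pos.ne'
      (div_ne_zero hβ_ne (pow_pos h.q_pos _).ne') ?_ ?_ <;> rw [h.div_pow_succ_mul]
    exacts [ih (d := d + 1) (fun _ => hβ_ne) d.succ_pos, ih (fun _ => hβ_ne) hd]

theorem hasOrthogonalityOrder_shift {k m : ℕ} (hα : ∀ i < k, α ≠ q ^ i) (hβ : m ≠ 0 → β ≠ 0)
    (l : ℕ) {d : ℕ} (hd : 0 < d) : HasOrthogonalityOrder h.functional
      (bigQJacobi q (α / q ^ k) (β / q ^ (l + m)) (γ / q ^ l) (k + l + m + d)) d := by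
  induction k generalizing d with
  | zero => simpa using h.hasOrthogonalityOrder_shift_β_γ hβ l hd
  | succ k ih =>
    have hα' : ∀ i < k, α ≠ q ^ i := fun i hi => hα i (hi.trans k.lt_succ_self)
    rw [show k + 1 + l + m + d = k + l + m + d + 1 by omega]
    refine .bigQJacobi_of_mul_q_left h.q_pos h.q_lt_one (h.regular hα (by omega))
      (div_ne_zero h.α_pos.ne' (pow_pos h.q_pos _).ne') (h.β_div_mul_pow_ne_one (by omega))
      ?_ ?_ <;> rw [h.div_pow_succ_mul]
    exacts [ih (d := d + 1) hα' d.succ_pos, ih hα' hd]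

theorem isQuasiOrthogonal_of_hasOrthogonalityOrder {Q : ℝ[X]} {n r : ℕ} (hr : r < n)
    (hdeg : Q.degree = n) (hQ : HasOrthogonalityOrder h.functional Q (n - r)) :
    IsQuasiOrthogonal q (γ * q) (α * q) (bigQJacobiWeight q α β γ) Q n r := by
  have heval (m : ℕ) : (fun x => x ^ m * Q.eval x * bigQJacobiWeight q α β γ x) =
      fun x => (X ^ m * Q).eval x * bigQJacobiWeight q α β γ x := by
    simp only [eval_mul, eval_pow, eval_X]
  refine ⟨fun x hx => h.weight_pos hx, hr, natDegree_eq_of_degree_eq_some hdeg, fun m => ?_,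
    fun m hm => ?_, ?_⟩ <;> rw [heval]
  · exact h.qIntegrable _
  · exact hQ.eq_zero _ ((degree_X_pow_le m).trans_lt (by exact_mod_cast hm))
  · exact hQ.ne_zero

end BigQJacobiParams

theorem theorem2p3_general (q α β γ : ℝ) (hq0 : 0 < q) (hq1 : q < 1)
    (hα0 : 0 < α * q) (hα1 : α * q < 1) (hβ0 : 0 ≤ β * q) (hβ1 : β * q < 1) (hγ : γ < 0)
    {k l m n : ℕ} (hα : ∀ i < k, α ≠ q ^ i) (hβ : m ≠ 0 → β ≠ 0) (hn : k + l + m < n) :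
    IsQuasiOrthogonal q (γ * q) (α * q) (bigQJacobiWeight q α β γ)
        (bigQJacobi q (α / q ^ k) (β / q ^ (l + m)) (γ / q ^ l) n) n (k + l + m) ∧
      HasAtLeastZeros (bigQJacobi q (α / q ^ k) (β / q ^ (l + m)) (γ / q ^ l) n)
        (n - (k + l + m)) (γ * q) (α * q) := by
  have h : BigQJacobiParams q α β γ := ⟨hq0, hq1, pos_of_mul_pos_left hα0 hq0.le, hα1,
    nonneg_of_mul_nonneg_left hβ0 hq0, hβ1, hγ⟩
  have horder : HasOrthogonalityOrder h.functional
      (bigQJacobi q (α / q ^ k) (β / q ^ (l + m)) (γ / q ^ l) n) (n - (k + l + m)) := by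
    simpa only [Nat.add_sub_cancel' hn.le] using
      h.hasOrthogonalityOrder_shift hα hβ l (Nat.sub_pos_of_lt hn)
  exact ⟨h.isQuasiOrthogonal_of_hasOrthogonalityOrder hn
      (degree_bigQJacobi hq0 hq1 (h.regular hα (Nat.le_sub_one_of_lt hn))) horder,
    horder.hasAtLeastZeros h.γ_mul_lt_α_mul fun _ => h.functional_pos⟩

theorem theorem2p3 (q α β γ : ℝ) (hq0 : 0 < q) (hq1 : q < 1)
    (hα0 : 0 < α * q) (hα1 : α * q < 1) (hβ0 : 0 ≤ β * q) (hβ1 : β * q < 1) (hγ : γ < 0) :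
    (1 < α → ∀ k n : ℕ, k < n →
      IsQuasiOrthogonal q (γ * q) (α * q) (bigQJacobiWeight q α β γ)
          (bigQJacobi q (α / q ^ k) β γ n) n k ∧
        HasAtLeastZeros (bigQJacobi q (α / q ^ k) β γ n) (n - k) (γ * q) (α * q)) ∧
    (1 < β → ∀ m n : ℕ, m < n →
      IsQuasiOrthogonal q (γ * q) (α * q) (bigQJacobiWeight q α β γ)
          (bigQJacobi q α (β / q ^ m) γ n) n m ∧
        HasAtLeastZeros (bigQJacobi q α (β / q ^ m) γ n) (n - m) (γ * q) (α * q)) ∧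
    (1 < β → ∀ l n : ℕ, l < n →
      IsQuasiOrthogonal q (γ * q) (α * q) (bigQJacobiWeight q α β γ)
          (bigQJacobi q α (β / q ^ l) (γ / q ^ l) n) n l ∧
        HasAtLeastZeros (bigQJacobi q α (β / q ^ l) (γ / q ^ l) n) (n - l) (γ * q) (α * q)) ∧
    (1 < α → 1 < β → ∀ k m n : ℕ, k + m < n →
      IsQuasiOrthogonal q (γ * q) (α * q) (bigQJacobiWeight q α β γ)
          (bigQJacobi q (α / q ^ k) (β / q ^ m) γ n) n (k + m) ∧
        HasAtLeastZeros (bigQJacobi q (α / q ^ k) (β / q ^ m) γ n) (n - (k + m))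
          (γ * q) (α * q)) := by
  have general {k l m n : ℕ} (hα : 0 < k → 1 < α) (hβ : m ≠ 0 → 1 < β) (hn : k + l + m < n) :=
    theorem2p3_general q α β γ hq0 hq1 hα0 hα1 hβ0 hβ1 hγ
      (fun i hi => ((pow_le_one₀ hq0.le hq1.le).trans_lt (hα (i.zero_le.trans_lt hi))).ne')
      (fun hm => (one_pos.trans (hβ hm)).ne') hn
  refine ⟨fun hα k n hn => ?_, fun hβ m n hn => ?_, fun _ l n hn => ?_,
    fun hα hβ k m n hn => ?_⟩
  · simpa using general (k := k) (l := 0) (m := 0) (fun _ => hα) (absurd rfl) (by simpa using hn)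
  · simpa using general (k := 0) (l := 0) (m := m) (by simp) (fun _ => hβ) (by simpa using hn)
  · simpa using general (k := 0) (l := l) (m := 0) (by simp) (by simp) (by simpa using hn)
  · simpa using general (k := k) (l := 0) (m := m) (fun _ => hα) (fun _ => hβ) (by simpa using hn)
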